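/- Let $n,m$ be positive integers, not both equal to $1$, and let $\Theta$ be a real $n\times m$ matrix with transpose ${}^{t}\Theta$. Let $|\cdot|_\infty$ denote the sup-norm. Let $\beta(\Theta)\in[-\infty,+\infty]$ be the supremum of the real numbers $\gamma$ for which there are infinitely many pairs $(x,y)\in\mathbb Z^m\times\mathbb Z^n$ with $x\neq 0$ and $|\Theta x-y|_\infty\le |x|_\infty^{-\gamma}$. Let $\alpha(\Theta)$ be the supremum of the real numbers $\gamma$ such that for every sufficiently large real $t$ there are $x\in\mathbb Z^m$, $y\in\mathbb Z^n$ with $0<|x|_\infty\le t$ and $|\Theta x-y|_\infty\le t^{-\gamma}$. Define $\beta({}^{t}\Theta)$ in the same way for the $m\times n$ matrix ${}^{t}\Theta$. Then: 1. $$\beta({}^{t}\Theta)\ \ge\ \frac{n\beta(\Theta)+n-1}{(m-1)\beta(\Theta)+m}.$$ 2. If $\alpha(\Theta)<\infty$, then $$\beta({}^{t}\Theta)\ \ge\ \frac{(n-1)(1+\beta(\Theta))-(1-\alpha(\Theta))}{(m-1)(1+\beta(\Theta))+(1-\alpha(\Theta))}.$$ 3. If the group $\{x\in\mathbb Z^m:\Theta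 x\in\mathbb Z^n\}$ does not have rank exactly $1$ (which is automatic when $\alpha(\Theta)<\infty$, since then this group is $\{0\}$), then $$\beta({}^{t}\Theta)\ \ge\ \frac{(n-1)(1+\beta(\Theta)^{-1})-(\alpha(\Theta)^{-1}-1)}{(m-1)(1+\beta(\Theta)^{-1})+(\alpha(\Theta)^{-1}-1)}.$$ Here the exponents may be $+\infty$. When $\beta(\Theta)=+\infty$, the right-hand side of 1 is read as $\frac{n}{m-1}$ and that of 2 as $\frac{n-1}{m-1}$ (their limits as $\beta(\Theta)\to+\infty$); in 3 one puts $(+\infty)^{-1}=0$; and a fraction with zero denominator is read as $+\infty$. -/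

import Mathlib

noncomputable section

namespace Diophantine

/-- The error vector `Θ x - y` for integer vectors `x` and `y`. The norm on `Fin n → ℝ` and on
`Fin m → ℤ` is the sup-norm. -/
def errorVec {n m : ℕ} (Θ : Matrix (Fin n) (Fin m) ℝ) (x : Fin m → ℤ) (y : Fin n → ℤ) :
    Fin n → ℝ :=
  Θ.mulVec (fun j => (x j : ℝ)) - fun i => (y i : ℝ)

/-- The individual Diophantine exponent `β(Θ)`: the supremum, in the extended reals, of the real
numbers `γ` such that `|Θ x - y| ≤ |x| ^ (-γ)` for infinitely many pairs of integer vectors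
`(x, y)` with `x ≠ 0`. -/
def individualExponent {n m : ℕ} (Θ : Matrix (Fin n) (Fin m) ℝ) : EReal :=
  sSup {g : EReal | ∃ γ : ℝ, g = (γ : EReal) ∧
    {p : (Fin m → ℤ) × (Fin n → ℤ) |
      p.1 ≠ 0 ∧ ‖errorVec Θ p.1 p.2‖ ≤ ‖p.1‖ ^ (-γ)}.Infinite}

/-- The uniform Diophantine exponent `α(Θ)`: the supremum, in the extended reals, of the real
numbers `γ` such that for every sufficiently large `t` there are integer vectors `x`, `y` with
`0 < |x| ≤ t` and `|Θ x - y| ≤ t ^ (-γ)`. -/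
def uniformExponent {n m : ℕ} (Θ : Matrix (Fin n) (Fin m) ℝ) : EReal :=
  sSup {g : EReal | ∃ γ : ℝ, g = (γ : EReal) ∧
    ∀ᶠ t : ℝ in Filter.atTop, ∃ (x : Fin m → ℤ) (y : Fin n → ℤ),
      0 < ‖x‖ ∧ ‖x‖ ≤ t ∧ ‖errorVec Θ x y‖ ≤ t ^ (-γ)}

/-- The integer vectors `x` for which `Θ x = y` has an integer solution `y`. This is a subgroup
of `ℤ ^ m`. -/
def exactSolutions {n m : ℕ} (Θ : Matrix (Fin n) (Fin m) ℝ) : Set (Fin m → ℤ) :=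
  {x | ∃ y : Fin n → ℤ, errorVec Θ x y = 0}

/-- The quotient `p / q` as an extended real, equal to `+∞` when the denominator vanishes
(it is used for expressions whose numerator is positive whenever the denominator is `0`). -/
def quot (p q : ℝ) : EReal :=
  if q = 0 then ⊤ else ((p / q : ℝ) : EReal)

/-- `(n β + n - 1) / ((m - 1) β + m)`, read as its limit `n / (m - 1)` at `β = +∞`. -/
def bound₁ (n m : ℕ) (β : EReal) : EReal :=
  if β = ⊤ then quot (n : ℝ) ((m : ℝ) - 1)
  else quot ((n : ℝ) * β.toReal + (n : ℝ) - 1) (((m : ℝ) - 1) * β.toReal + (m : ℝ))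

/-- `((n - 1) (1 + β) - (1 - α)) / ((m - 1) (1 + β) + (1 - α))` for finite `α`, read as its
limit `(n - 1) / (m - 1)` at `β = +∞`. -/
def bound₂ (n m : ℕ) (α : ℝ) (β : EReal) : EReal :=
  if β = ⊤ then quot ((n : ℝ) - 1) ((m : ℝ) - 1)
  else quot (((n : ℝ) - 1) * (1 + β.toReal) - (1 - α))
    (((m : ℝ) - 1) * (1 + β.toReal) + (1 - α))

/-- `((n - 1) (1 + β⁻¹) - (α⁻¹ - 1)) / ((m - 1) (1 + β⁻¹) + (α⁻¹ - 1))`, where the inverse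
of `+∞` is `0`. -/
def bound₃ (n m : ℕ) (α β : EReal) : EReal :=
  quot (((n : ℝ) - 1) * (1 + (β⁻¹).toReal) - ((α⁻¹).toReal - 1))
    (((m : ℝ) - 1) * (1 + (β⁻¹).toReal) + ((α⁻¹).toReal - 1))

end Diophantine

end

open Filter Topology MeasureTheory

/-! A pair `(x, y)` acts on pairs `(x', y')` by the integer `y·y' - x·x' = x·(ᵗΘ y' - x') - (Θ x -
y)·y'`. Hence an approximation for `Θ` is an integral linear form in the quantities `ᵗΘ y' - x'` and
`y'`, with coefficients `x` and `-(Θ x - y)`. In the box `|ᵗΘ y' - x'| ≤ V`, `|y'| ≤ Y`, replace the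
inequality at the largest coefficient by `|form| < 1`. Minkowski's theorem gives an integer point;
the form, being integral, vanishes there, and the dropped coordinate is recovered up to a constant.
The volume condition thus weakens to `A < V ^ m * Y ^ n`, with `A` the largest coefficient after
scaling, and with two independent forms to `2 * A * B < V ^ m * Y ^ n` (`exists_transpose_approx`,
`exists_transpose_approx_of_two`).

The first bound uses one form. The other two pair a primitive good approximation `(x₁, y₁)` with one
supplied by the uniform exponent, either with `x₂` shorter than `x₁` or with error smaller than that
of `x₁`. Primitivity makes every proportional integer pair an integer multiple, so the second pair
is independent of the first. Taking `V` and `Y` to be powers of a parameter `R` turns the volume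
condition into the stated fractions. -/

namespace Diophantine

/-! ### Geometry of numbers with integral linear forms -/

/-- Minkowski's theorem on linear forms. -/
theorem exists_int_mulVec_lt_one {ι : Type*} [Fintype ι] [DecidableEq ι] (M : Matrix ι ι ℝ)
    (h0 : M.det ≠ 0) (h1 : |M.det| < 1) :
    ∃ w : ι → ℤ, w ≠ 0 ∧ ∀ k, |M.mulVec (fun i => (w i : ℝ)) k| < 1 := by
  set b := Pi.basisFun ℝ ι
  set s : Set (ι → ℝ) := M.toLin' ⁻¹' (Set.univ.pi fun _ => Set.Ioo (-1 : ℝ) 1) with hs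
  have hmem : ∀ x, x ∈ s ↔ ∀ k, |M.mulVec x k| < 1 := by
    intro x; simp [hs, abs_lt, Set.mem_pi]
  -- The cube has side `2`, so `|M.det| < 1` is exactly the strict volume condition of Minkowski's
  -- convex body theorem.
  have hvol : volume s = ENNReal.ofReal |M.det|⁻¹ * 2 ^ Module.finrank ℝ (ι → ℝ) := by
    rw [hs, Measure.addHaar_preimage_linearMap _ (by simpa using h0), volume_pi, Measure.pi_pi]
    simp [Real.volume_Ioo, abs_inv]
    norm_num
  have hF : volume (ZSpan.fundamentalDomain b) = 1 := by
    rw [ZSpan.volume_fundamentalDomain]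
    have : Matrix.of (b : ι → ι → ℝ) = 1 := by
      ext i j
      simp [b, Matrix.one_apply, Pi.single_apply, eq_comm]
    simp [this]
  have fund := ZSpan.isAddFundamentalDomain' b volume
  have : Countable (Submodule.span ℤ (Set.range b)).toAddSubgroup :=
    inferInstanceAs (Countable (Submodule.span ℤ (Set.range b)))
  obtain ⟨⟨x, hx⟩, hx0, hxs⟩ := exists_ne_zero_mem_lattice_of_measure_mul_two_pow_lt_measure
    (s := s) fund
    (by intro x hx; rw [hmem] at *; simpa [Matrix.mulVec_neg] using hx)
    (by
      rw [hs]
      exact (convex_pi fun _ _ => convex_Ioo _ _).linear_preimage _)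
    (by
      rw [hF, one_mul, hvol]
      have h2 : (1 : ENNReal) < ENNReal.ofReal |M.det|⁻¹ := by
        rw [ENNReal.one_lt_ofReal]
        exact (one_lt_inv₀ (abs_pos.2 h0)).2 h1
      calc (2 : ENNReal) ^ Module.finrank ℝ (ι → ℝ)
          = 1 * 2 ^ Module.finrank ℝ (ι → ℝ) := (one_mul _).symm
        _ < _ := by
          gcongr
          exact ENNReal.pow_ne_top ENNReal.ofNat_ne_top)
  have hx' : ∀ i, ∃ z : ℤ, (z : ℝ) = x i := by
    have h := (b.mem_span_iff_repr_mem ℤ x).1 hx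
    intro i
    simpa [b] using h i
  choose w hw using hx'
  have hxw : x = fun i => (w i : ℝ) := funext fun i => (hw i).symm
  refine ⟨w, ?_, ?_⟩
  · rintro rfl
    exact hx0 (Subtype.ext (by simpa [funext_iff] using hxw))
  · rw [← hxw]
    exact (hmem x).1 hxs

/-- Multiplying by this matrix trades the `i`-th coordinate for the form `c`, at the cost of a
factor `c i` in the volume. -/
theorem det_one_updateRow {ι : Type*} [Fintype ι] [DecidableEq ι] (i : ι) (c : ι → ℝ) :
    ((1 : Matrix ι ι ℝ).updateRow i c).det = c i := by
  rw [← Matrix.cramer_transpose_apply, Matrix.transpose_one, Matrix.cramer_one]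
  rfl

theorem one_updateRow_mulVec {ι : Type*} [Fintype ι] [DecidableEq ι] (i : ι) (c t : ι → ℝ) :
    ((1 : Matrix ι ι ℝ).updateRow i c).mulVec t = Function.update t i (c ⬝ᵥ t) := by
  rw [Matrix.updateRow_mulVec, Matrix.one_mulVec]

theorem exists_pivot {ι : Type*} [Fintype ι] (c : ι → ℝ) (hc : c ≠ 0) :
    ∃ i, c i ≠ 0 ∧ ∀ k, |c k| ≤ |c i| := by
  obtain ⟨k, hk⟩ := Function.ne_iff.1 hc
  obtain ⟨i, -, hi⟩ := Finset.exists_max_image Finset.univ (fun k => |c k|) ⟨k, Finset.mem_univ k⟩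
  exact ⟨i, abs_pos.1 ((abs_pos.2 hk).trans_le (hi k (Finset.mem_univ _))),
    fun k => hi k (Finset.mem_univ _)⟩

/-- If a linear form with largest coefficient at `i` vanishes at `t`, and the other coordinates of
`t` that occur in it are bounded by `B`, then the `i`-th one is bounded by a multiple of `B`. -/
theorem abs_pivot_le {ι : Type*} [Fintype ι] [DecidableEq ι] (c t : ι → ℝ) (i : ι) (hi : c i ≠ 0)
    (hmax : ∀ k, |c k| ≤ |c i|) (h0 : c ⬝ᵥ t = 0) (B : ℝ) (hB0 : 0 ≤ B)
    (hB : ∀ k ≠ i, c k ≠ 0 → |t k| ≤ B) : |t i| ≤ Fintype.card ι * B := by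
  have h1 : c i * t i = -∑ k ∈ Finset.univ.erase i, c k * t k := by
    rw [dotProduct, ← Finset.add_sum_erase _ _ (Finset.mem_univ i)] at h0
    linarith
  have h2 : |c i| * |t i| ≤ |c i| * (Fintype.card ι * B) := by
    rw [← abs_mul, h1, abs_neg]
    calc |∑ k ∈ Finset.univ.erase i, c k * t k|
        ≤ ∑ k ∈ Finset.univ.erase i, |c k * t k| := Finset.abs_sum_le_sum_abs _ _
      _ ≤ ∑ k ∈ Finset.univ.erase i, |c i| * B := by
          refine Finset.sum_le_sum fun k hk => ?_
          rw [abs_mul]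
          by_cases h : c k = 0
          · rw [h, abs_zero, zero_mul]; positivity
          · exact mul_le_mul (hmax k) (hB k (Finset.ne_of_mem_erase hk) h) (abs_nonneg _)
              (abs_nonneg _)
      _ ≤ ∑ k : ι, |c i| * B :=
          Finset.sum_le_sum_of_subset_of_nonneg (Finset.erase_subset _ _)
            fun _ _ _ => by positivity
      _ = _ := by rw [Finset.sum_const, Finset.card_univ, nsmul_eq_mul]; ring
  exact le_of_mul_le_mul_left h2 (abs_pos.2 hi)

theorem eq_zero_of_abs_lt_one_of_int {r : ℝ} (h : |r| < 1) (hr : ∃ z : ℤ, r = z) : r = 0 := by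
  obtain ⟨z, rfl⟩ := hr
  have : |z| < 1 := by exact_mod_cast h
  simp [Int.abs_lt_one_iff.1 this]

/-- Small integer points on which one given integral linear form vanishes. -/
theorem exists_int_mulVec_le_of_form {ι : Type*} [Fintype ι] [DecidableEq ι] (T : Matrix ι ι ℝ)
    (hT : T.det ≠ 0) (c : ι → ℝ) (hc : c ≠ 0) (A : ℝ) (hA : ∀ k, |c k| ≤ A)
    (hvol : A * |T.det| < 1)
    (hint : ∀ w : ι → ℤ, ∃ z : ℤ, c ⬝ᵥ T.mulVec (fun i => (w i : ℝ)) = z) :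
    ∃ w : ι → ℤ, w ≠ 0 ∧ ∀ k, |T.mulVec (fun i => (w i : ℝ)) k| ≤ (Fintype.card ι : ℝ) := by
  obtain ⟨i, hi, hmax⟩ := exists_pivot c hc
  obtain ⟨w, hw, hlt⟩ := exists_int_mulVec_lt_one ((1 : Matrix ι ι ℝ).updateRow i c * T)
    (by rw [Matrix.det_mul, det_one_updateRow]; exact mul_ne_zero hi hT)
    (by
      rw [Matrix.det_mul, det_one_updateRow, abs_mul]
      exact (mul_le_mul_of_nonneg_right (hA i) (abs_nonneg _)).trans_lt hvol)
  refine ⟨w, hw, ?_⟩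
  set t := T.mulVec (fun i => (w i : ℝ)) with ht
  simp only [← Matrix.mulVec_mulVec, one_updateRow_mulVec, ← ht] at hlt
  have h0 : c ⬝ᵥ t = 0 :=
    eq_zero_of_abs_lt_one_of_int (by simpa using hlt i) (hint w)
  have hk : ∀ k ≠ i, |t k| ≤ 1 := fun k hk => by simpa [hk] using (hlt k).le
  have hcard : (1 : ℝ) ≤ Fintype.card ι := by
    exact_mod_cast Fintype.card_pos_iff.2 ⟨i⟩
  intro k
  by_cases hki : k = i
  · subst hki
    simpa using abs_pivot_le c t k hi hmax h0 1 zero_le_one fun j hj _ => hk j hj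
  · exact (hk k hki).trans hcard

/-- Small integer points on which two given independent integral linear forms vanish. -/
theorem exists_int_mulVec_le_of_two_forms {ι : Type*} [Fintype ι] [DecidableEq ι]
    (T : Matrix ι ι ℝ) (hT : T.det ≠ 0) (c₁ c₂ : ι → ℝ) (hc₁ : c₁ ≠ 0)
    (hc₂ : ∀ r : ℝ, c₂ ≠ r • c₁) (A B : ℝ) (hA : ∀ k, |c₁ k| ≤ A) (hB : ∀ k, |c₂ k| ≤ B)
    (hvol : 2 * A * B * |T.det| < 1)
    (hint₁ : ∀ w : ι → ℤ, ∃ z : ℤ, c₁ ⬝ᵥ T.mulVec (fun i => (w i : ℝ)) = z)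
    (hint₂ : ∀ w : ι → ℤ, ∃ z : ℤ, c₂ ⬝ᵥ T.mulVec (fun i => (w i : ℝ)) = z) :
    ∃ w : ι → ℤ, w ≠ 0 ∧
      ∀ k, |T.mulVec (fun i => (w i : ℝ)) k| ≤ (Fintype.card ι : ℝ) ^ 2 := by
  obtain ⟨i, hi, hmax⟩ := exists_pivot c₁ hc₁
  -- Eliminating the pivot `i` of `c₁` from `c₂` decouples the two substitutions. Since `i` is a
  -- largest entry of `c₁`, this at most doubles the bound `B`.
  set r : ℝ := c₂ i / c₁ i with hr
  set c : ι → ℝ := c₂ - r • c₁ with hc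
  have hc0 : c ≠ 0 := fun h => hc₂ r (sub_eq_zero.1 h)
  have hci : c i = 0 := by simp [hc, hr, hi]
  have hcB : ∀ k, |c k| ≤ 2 * B := by
    intro k
    have h1 : |r * c₁ k| ≤ |c₂ i| := by
      rw [hr, abs_mul, abs_div, div_mul_eq_mul_div, div_le_iff₀ (abs_pos.2 hi)]
      exact mul_le_mul_of_nonneg_left (hmax k) (abs_nonneg _)
    calc |c k| ≤ |c₂ k| + |r * c₁ k| := by simpa [hc] using abs_sub (c₂ k) (r * c₁ k)
      _ ≤ B + B := add_le_add (hB k) (h1.trans (hB i))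
      _ = 2 * B := by ring
  obtain ⟨j, hj, hjmax⟩ := exists_pivot c hc0
  have hji : j ≠ i := fun h => hj (h ▸ hci)
  obtain ⟨w, hw, hlt⟩ := exists_int_mulVec_lt_one
    ((1 : Matrix ι ι ℝ).updateRow j c * ((1 : Matrix ι ι ℝ).updateRow i c₁ * T))
    (by
      rw [Matrix.det_mul, Matrix.det_mul, det_one_updateRow, det_one_updateRow]
      exact mul_ne_zero hj (mul_ne_zero hi hT))
    (by
      rw [Matrix.det_mul, Matrix.det_mul, det_one_updateRow, det_one_updateRow, abs_mul, abs_mul]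
      refine lt_of_le_of_lt ?_ hvol
      calc |c j| * (|c₁ i| * |T.det|) ≤ (2 * B) * (A * |T.det|) :=
            mul_le_mul (hcB j) (mul_le_mul_of_nonneg_right (hA i) (abs_nonneg _))
              (by positivity) ((abs_nonneg _).trans (hcB j))
        _ = _ := by ring)
  refine ⟨w, hw, ?_⟩
  set t := T.mulVec (fun i => (w i : ℝ)) with ht
  simp only [← Matrix.mulVec_mulVec, one_updateRow_mulVec, ← ht] at hlt
  have hct : c ⬝ᵥ Function.update t i (c₁ ⬝ᵥ t) = c ⬝ᵥ t := by
    simp only [dotProduct]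
    refine Finset.sum_congr rfl fun k _ => ?_
    by_cases h : k = i
    · subst h; simp [hci]
    · simp [h]
  have h0 : c₁ ⬝ᵥ t = 0 := by
    refine eq_zero_of_abs_lt_one_of_int ?_ (hint₁ w)
    simpa [hji.symm] using hlt i
  have hcc : c ⬝ᵥ t = c₂ ⬝ᵥ t := by
    rw [hc, sub_dotProduct, smul_dotProduct, h0, smul_zero, sub_zero]
  -- The combination `c` is not integral in general; it takes an integer value at `t` because `c₁`
  -- already vanishes there.
  have h0' : c ⬝ᵥ t = 0 := by
    refine eq_zero_of_abs_lt_one_of_int ?_ (hcc ▸ hint₂ w)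
    simpa [hct] using hlt j
  have hk : ∀ k ≠ i, k ≠ j → |t k| ≤ 1 := fun k hk hk' => by
    simpa [hk, hk'] using (hlt k).le
  have hcard : (1 : ℝ) ≤ Fintype.card ι := by
    exact_mod_cast Fintype.card_pos_iff.2 ⟨i⟩
  -- Back substitution: `c` does not involve coordinate `i`, so it bounds `t j` first; then `c₁`
  -- bounds `t i`, whence the square.
  have htj : |t j| ≤ Fintype.card ι := by
    simpa using abs_pivot_le c t j hj hjmax h0' 1 zero_le_one fun k hkj hck =>
      hk k (fun h => hck (h ▸ hci)) hkj
  have hk' : ∀ k ≠ i, |t k| ≤ Fintype.card ι := fun k hki => by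
    by_cases h : k = j
    · exact h ▸ htj
    · exact (hk k hki h).trans hcard
  intro k
  rw [sq]
  by_cases hki : k = i
  · subst hki
    exact abs_pivot_le c₁ t k hi hmax h0 _ (by positivity) fun l hl _ => hk' l hl
  · exact (hk' k hki).trans (le_mul_of_one_le_left (by positivity) hcard)

/-! ### Duality between approximations to `Θ` and to its transpose -/

theorem norm_int_cast {k : ℕ} (x : Fin k → ℤ) : ‖fun i => (x i : ℝ)‖ = ‖x‖ := by
  rfl

theorem one_le_norm {k : ℕ} {x : Fin k → ℤ} (hx : x ≠ 0) : 1 ≤ ‖x‖ := by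
  obtain ⟨i, hi⟩ := Function.ne_iff.1 hx
  have h : (1 : ℝ) ≤ ‖x i‖ := by
    rw [Int.norm_eq_abs]
    exact_mod_cast Int.one_le_abs hi
  exact h.trans (norm_le_pi_norm x i)

noncomputable section

/-- The linear map `(x', y') ↦ ((ᵗΘ y' - x') / V, y' / Y)`. -/
def dualMatrix {n m : ℕ} (Θ : Matrix (Fin n) (Fin m) ℝ) (V Y : ℝ) :
    Matrix (Fin m ⊕ Fin n) (Fin m ⊕ Fin n) ℝ :=
  Matrix.fromBlocks ((-V⁻¹) • 1) (V⁻¹ • Θ.transpose) 0 (Y⁻¹ • 1)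

theorem abs_det_dualMatrix {n m : ℕ} (Θ : Matrix (Fin n) (Fin m) ℝ) {V Y : ℝ} (hV : 0 < V)
    (hY : 0 < Y) : |(dualMatrix Θ V Y).det| = (V ^ m * Y ^ n)⁻¹ := by
  rw [dualMatrix, Matrix.det_fromBlocks_zero₂₁, Matrix.det_smul, Matrix.det_smul]
  simp [abs_mul, abs_of_pos hV, abs_of_pos hY, mul_comm]

theorem dualMatrix_mulVec {n m : ℕ} (Θ : Matrix (Fin n) (Fin m) ℝ) (V Y : ℝ)
    (w : Fin m ⊕ Fin n → ℤ) :
    (dualMatrix Θ V Y).mulVec (fun i => (w i : ℝ)) =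
      Sum.elim (fun j => V⁻¹ * errorVec Θ.transpose (w ∘ Sum.inr) (w ∘ Sum.inl) j)
        (fun i => Y⁻¹ * (w (Sum.inr i) : ℝ)) := by
  rw [dualMatrix, Matrix.fromBlocks_mulVec]
  ext k
  rcases k with j | i
  · simp only [Sum.elim_inl, errorVec, Pi.add_apply, Matrix.smul_mulVec, Matrix.one_mulVec,
      Pi.smul_apply, smul_eq_mul, Pi.sub_apply, Function.comp_apply]
    simp only [Function.comp_def]
    ring
  · simp [Matrix.smul_mulVec, Function.comp_def]

/-- The integral linear form attached to a pair `(x, y)`, in the coordinates of `dualMatrix`. -/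
def dualForm {n m : ℕ} (Θ : Matrix (Fin n) (Fin m) ℝ) (V Y : ℝ) (x : Fin m → ℤ)
    (y : Fin n → ℤ) : Fin m ⊕ Fin n → ℝ :=
  Sum.elim (fun j => V * (x j : ℝ)) (fun i => -(Y * errorVec Θ x y i))

/-- The scalings by `V` and `Y` cancel and the two terms containing `Θ` agree by transposition,
leaving `y·y' - x·x'`. -/
theorem dualForm_dotProduct {n m : ℕ} (Θ : Matrix (Fin n) (Fin m) ℝ) {V Y : ℝ} (hV : 0 < V)
    (hY : 0 < Y) (x : Fin m → ℤ) (y : Fin n → ℤ) (w : Fin m ⊕ Fin n → ℤ) :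
    ∃ z : ℤ, dualForm Θ V Y x y ⬝ᵥ (dualMatrix Θ V Y).mulVec (fun i => (w i : ℝ)) = z := by
  refine ⟨y ⬝ᵥ (w ∘ Sum.inr) - x ⬝ᵥ (w ∘ Sum.inl), ?_⟩
  rw [dualMatrix_mulVec, dualForm, sumElim_dotProduct_sumElim]
  set x' : Fin m → ℝ := fun j => (x j : ℝ) with hx'
  set y' : Fin n → ℝ := fun i => (y i : ℝ) with hy'
  set v : Fin m → ℝ := fun j => (w (Sum.inl j) : ℝ) with hv
  set u : Fin n → ℝ := fun i => (w (Sum.inr i) : ℝ) with hu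
  have h1 : (fun j => V * (x j : ℝ)) ⬝ᵥ
      (fun j => V⁻¹ * errorVec Θ.transpose (w ∘ Sum.inr) (w ∘ Sum.inl) j) =
      x' ⬝ᵥ (Θ.transpose.mulVec u - v) := by
    refine Finset.sum_congr rfl fun j _ => ?_
    rw [mul_mul_mul_comm, mul_inv_cancel₀ hV.ne', one_mul]
    rfl
  have h2 : (fun i => -(Y * errorVec Θ x y i)) ⬝ᵥ (fun i => Y⁻¹ * (w (Sum.inr i) : ℝ)) =
      -((Θ.mulVec x' - y') ⬝ᵥ u) := by
    rw [dotProduct, dotProduct, ← Finset.sum_neg_distrib]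
    refine Finset.sum_congr rfl fun i _ => ?_
    rw [neg_mul, mul_mul_mul_comm, mul_inv_cancel₀ hY.ne', one_mul]
    rfl
  have h3 : x' ⬝ᵥ Θ.transpose.mulVec u = Θ.mulVec x' ⬝ᵥ u := by
    rw [Matrix.mulVec_transpose, dotProduct_comm, ← Matrix.dotProduct_mulVec, dotProduct_comm]
  rw [h1, h2, dotProduct_sub, sub_dotProduct, h3]
  simp only [dotProduct, Int.cast_sub, Int.cast_sum, Int.cast_mul, Function.comp_apply, hx', hy',
    hv, hu]
  ring

theorem abs_dualForm_le {n m : ℕ} (Θ : Matrix (Fin n) (Fin m) ℝ) {V Y A : ℝ} (hV : 0 < V)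
    (hY : 0 < Y) (x : Fin m → ℤ) (y : Fin n → ℤ) (hx : V * ‖x‖ ≤ A)
    (hu : Y * ‖errorVec Θ x y‖ ≤ A) (k : Fin m ⊕ Fin n) : |dualForm Θ V Y x y k| ≤ A := by
  rcases k with j | i
  · refine le_trans ?_ hx
    simp only [dualForm, Sum.elim_inl, abs_mul, abs_of_pos hV]
    gcongr
    rw [← norm_int_cast]
    exact norm_le_pi_norm (fun j => (x j : ℝ)) j
  · refine le_trans ?_ hu
    simp only [dualForm, Sum.elim_inr, abs_mul, abs_neg, abs_of_pos hY]
    gcongr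
    exact norm_le_pi_norm (errorVec Θ x y) i

theorem norm_le_of_dualMatrix {n m : ℕ} (Θ : Matrix (Fin n) (Fin m) ℝ) {V Y C : ℝ} (hV : 0 < V)
    (hY : 0 < Y) (hC : 0 ≤ C) (w : Fin m ⊕ Fin n → ℤ)
    (h : ∀ k, |(dualMatrix Θ V Y).mulVec (fun i => (w i : ℝ)) k| ≤ C) :
    ‖w ∘ Sum.inr‖ ≤ C * Y ∧
      ‖errorVec Θ.transpose (w ∘ Sum.inr) (w ∘ Sum.inl)‖ ≤ C * V := by
  rw [dualMatrix_mulVec] at h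
  constructor
  · rw [← norm_int_cast, pi_norm_le_iff_of_nonneg (by positivity)]
    intro i
    have := h (Sum.inr i)
    rw [Sum.elim_inr, abs_mul, abs_of_pos (inv_pos.2 hY), inv_mul_le_iff₀ hY] at this
    rw [mul_comm]
    exact this
  · rw [pi_norm_le_iff_of_nonneg (by positivity)]
    intro j
    have := h (Sum.inl j)
    rw [Sum.elim_inl, abs_mul, abs_of_pos (inv_pos.2 hV), inv_mul_le_iff₀ hV] at this
    rw [mul_comm]
    exact this

theorem det_dualMatrix_ne_zero {n m : ℕ} (Θ : Matrix (Fin n) (Fin m) ℝ) {V Y : ℝ} (hV : 0 < V)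
    (hY : 0 < Y) : (dualMatrix Θ V Y).det ≠ 0 := by
  rw [← abs_pos, abs_det_dualMatrix Θ hV hY]
  positivity

theorem pair_ne_zero {n m : ℕ} {w : Fin m ⊕ Fin n → ℤ} (hw : w ≠ 0) :
    ¬ (w ∘ Sum.inr = 0 ∧ w ∘ Sum.inl = 0) := by
  rintro ⟨h1, h2⟩
  apply hw
  ext k
  rcases k with j | i
  · exact congrFun h2 j
  · exact congrFun h1 i

theorem dualForm_ne_zero {n m : ℕ} (Θ : Matrix (Fin n) (Fin m) ℝ) {V : ℝ} (Y : ℝ) (hV : 0 < V)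
    {x : Fin m → ℤ} (y : Fin n → ℤ) (hx : x ≠ 0) : dualForm Θ V Y x y ≠ 0 := by
  intro h
  apply hx
  ext j
  have := congrFun h (Sum.inl j)
  simpa [dualForm, hV.ne'] using this

/-- One good approximation to `Θ` yields a good approximation to `ᵗΘ`. -/
theorem exists_transpose_approx {n m : ℕ} (Θ : Matrix (Fin n) (Fin m) ℝ) {V Y A : ℝ}
    (hV : 0 < V) (hY : 0 < Y) (x : Fin m → ℤ) (y : Fin n → ℤ) (hx : x ≠ 0) (hxA : V * ‖x‖ ≤ A)
    (huA : Y * ‖errorVec Θ x y‖ ≤ A) (hA : A < V ^ m * Y ^ n) :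
    ∃ (y' : Fin n → ℤ) (x' : Fin m → ℤ), ¬ (y' = 0 ∧ x' = 0) ∧
      ‖y'‖ ≤ ((m + n : ℕ) : ℝ) ^ 2 * Y ∧
      ‖errorVec Θ.transpose y' x'‖ ≤ ((m + n : ℕ) : ℝ) ^ 2 * V := by
  obtain ⟨w, hw, h⟩ := exists_int_mulVec_le_of_form (dualMatrix Θ V Y)
    (det_dualMatrix_ne_zero Θ hV hY) (dualForm Θ V Y x y) (dualForm_ne_zero Θ Y hV y hx) A
    (abs_dualForm_le Θ hV hY x y hxA huA)
    (by
      rw [abs_det_dualMatrix Θ hV hY, ← div_eq_mul_inv, div_lt_one (by positivity)]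
      exact hA)
    (dualForm_dotProduct Θ hV hY x y)
  simp only [Fintype.card_sum, Fintype.card_fin] at h
  have hle : ((m + n : ℕ) : ℝ) ≤ ((m + n : ℕ) : ℝ) ^ 2 := by
    exact_mod_cast Nat.le_self_pow two_ne_zero _
  exact ⟨_, _, pair_ne_zero hw, norm_le_of_dualMatrix Θ hV hY (by positivity) w
    fun k => (h k).trans hle⟩

/-- Two independent good approximations to `Θ` yield a good approximation to `ᵗΘ`. -/
theorem exists_transpose_approx_of_two {n m : ℕ} (Θ : Matrix (Fin n) (Fin m) ℝ) {V Y A B : ℝ}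
    (hV : 0 < V) (hY : 0 < Y) (x₁ x₂ : Fin m → ℤ) (y₁ y₂ : Fin n → ℤ) (hx₁ : x₁ ≠ 0)
    (hind : ∀ r : ℝ, ¬ ((∀ j, (x₂ j : ℝ) = r * x₁ j) ∧
      errorVec Θ x₂ y₂ = r • errorVec Θ x₁ y₁))
    (hxA : V * ‖x₁‖ ≤ A) (huA : Y * ‖errorVec Θ x₁ y₁‖ ≤ A)
    (hxB : V * ‖x₂‖ ≤ B) (huB : Y * ‖errorVec Θ x₂ y₂‖ ≤ B)
    (hAB : 2 * A * B < V ^ m * Y ^ n) :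
    ∃ (y' : Fin n → ℤ) (x' : Fin m → ℤ), ¬ (y' = 0 ∧ x' = 0) ∧
      ‖y'‖ ≤ ((m + n : ℕ) : ℝ) ^ 2 * Y ∧
      ‖errorVec Θ.transpose y' x'‖ ≤ ((m + n : ℕ) : ℝ) ^ 2 * V := by
  obtain ⟨w, hw, h⟩ := exists_int_mulVec_le_of_two_forms (dualMatrix Θ V Y)
    (det_dualMatrix_ne_zero Θ hV hY) (dualForm Θ V Y x₁ y₁) (dualForm Θ V Y x₂ y₂)
    (dualForm_ne_zero Θ Y hV y₁ hx₁)
    (by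
      intro r hr
      refine hind r ⟨fun j => ?_, funext fun i => ?_⟩
      · have := congrFun hr (Sum.inl j)
        simp only [dualForm, Sum.elim_inl, Pi.smul_apply, smul_eq_mul] at this
        exact mul_left_cancel₀ hV.ne' (by linarith)
      · have := congrFun hr (Sum.inr i)
        simp only [dualForm, Sum.elim_inr, Pi.smul_apply, smul_eq_mul] at this
        exact mul_left_cancel₀ hY.ne' (by simp only [Pi.smul_apply, smul_eq_mul]; linarith))
    A B (abs_dualForm_le Θ hV hY x₁ y₁ hxA huA) (abs_dualForm_le Θ hV hY x₂ y₂ hxB huB)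
    (by
      rw [abs_det_dualMatrix Θ hV hY, ← div_eq_mul_inv, div_lt_one (by positivity)]
      exact hAB)
    (dualForm_dotProduct Θ hV hY x₁ y₁) (dualForm_dotProduct Θ hV hY x₂ y₂)
  simp only [Fintype.card_sum, Fintype.card_fin] at h
  exact ⟨_, _, pair_ne_zero hw, norm_le_of_dualMatrix Θ hV hY (by positivity) w h⟩

end

/-! ### Exponents, primitive pairs and exact solutions -/

section

variable {n m : ℕ} (Θ : Matrix (Fin n) (Fin m) ℝ)

theorem errorVec_smul (k : ℤ) (x : Fin m → ℤ) (y : Fin n → ℤ) :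
    errorVec Θ (k • x) (k • y) = (k : ℝ) • errorVec Θ x y := by
  have h : (fun j => (((k • x) j : ℤ) : ℝ)) = (k : ℝ) • fun j => (x j : ℝ) := by
    ext j; simp
  unfold errorVec
  rw [h, Matrix.mulVec_smul, smul_sub]
  congr 1
  ext i; simp

theorem finite_pairs (R : ℝ) :
    {p : (Fin m → ℤ) × (Fin n → ℤ) | ‖p.1‖ ≤ R ∧ ‖errorVec Θ p.1 p.2‖ ≤ 1}.Finite := by
  have hball : ∀ (k : ℕ) (r : ℝ), {x : Fin k → ℤ | ‖x‖ ≤ r}.Finite := by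
    intro k r
    have := (isCompact_closedBall (0 : Fin k → ℤ) r).finite_of_discrete
    refine this.subset fun x hx => ?_
    simpa using hx
  refine ((hball m R).biUnion fun x _ => ((hball n
    (‖Θ.mulVec fun j => (x j : ℝ)‖ + 1)).image fun y => (x, y))).subset ?_
  rintro ⟨x, y⟩ ⟨hx, hy⟩
  simp only [Set.mem_iUnion, Set.mem_image, Set.mem_ofPred_eq]
  refine ⟨x, hx, y, ?_, rfl⟩
  rw [← norm_int_cast]
  have := norm_sub_norm_le (fun i => (y i : ℝ)) (Θ.mulVec fun j => (x j : ℝ))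
  rw [norm_sub_rev] at this
  have h2 : ‖(Θ.mulVec fun j => (x j : ℝ)) - fun i => (y i : ℝ)‖ ≤ 1 := hy
  linarith

theorem exists_pos_le_of_finite {α : Type*} {s : Set α} (hs : s.Finite) (f : α → ℝ)
    (hf : ∀ a ∈ s, 0 < f a) : ∃ ε > 0, ∀ a ∈ s, ε ≤ f a := by
  rcases s.eq_empty_or_nonempty with rfl | hne
  · exact ⟨1, one_pos, by simp⟩
  · obtain ⟨a, ha, h⟩ := Set.exists_min_image s f hs hne
    exact ⟨f a, hf a ha, h⟩

/-- If `Θ` has no exact integer solutions, very good approximations have large size. -/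
theorem exists_eps_norm_gt (hΘ : ∀ x y, x ≠ 0 → errorVec Θ x y ≠ 0) (R : ℝ) :
    ∃ ε > 0, ∀ x y, x ≠ 0 → ‖errorVec Θ x y‖ < ε → R < ‖x‖ := by
  obtain ⟨ε, hε, h⟩ := exists_pos_le_of_finite
    ((finite_pairs Θ R).subset (t := {p : (Fin m → ℤ) × (Fin n → ℤ) | p.1 ≠ 0 ∧ ‖p.1‖ ≤ R ∧ ‖errorVec Θ p.1 p.2‖ ≤ 1})
      fun p hp => hp.2) (fun p => ‖errorVec Θ p.1 p.2‖)
      (fun p hp => norm_pos_iff.2 (hΘ _ _ hp.1))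
  refine ⟨min ε 1, lt_min hε one_pos, fun x y hx hxy => ?_⟩
  by_contra! hR
  exact (hxy.trans_le (min_le_left _ _)).not_ge
    (h (x, y) ⟨hx, hR, (hxy.trans_le (min_le_right _ _)).le⟩)

/-- Arbitrarily small errors force infinitely many pairs: finitely many nonzero errors have a
positive minimum, and an exact solution has infinitely many multiples. -/
theorem le_individualExponent_of_forall_exists {γ : ℝ}
    (h : ∀ ε > 0, ∃ x y, x ≠ 0 ∧ ‖errorVec Θ x y‖ < ε ∧ ‖errorVec Θ x y‖ ≤ ‖x‖ ^ (-γ)) :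
    (γ : EReal) ≤ individualExponent Θ := by
  refine le_sSup ⟨γ, rfl, ?_⟩
  by_cases hex : ∃ x y, x ≠ 0 ∧ errorVec Θ x y = 0
  · obtain ⟨x, y, hx, hxy⟩ := hex
    refine Set.infinite_of_injective_forall_mem
      (f := fun k : ℕ => (((k + 1 : ℕ) : ℤ) • x, ((k + 1 : ℕ) : ℤ) • y)) ?_ ?_
    · intro k l hkl
      have h1 := congrArg Prod.fst hkl
      simp only at h1
      have := smul_left_injective ℤ hx h1
      simpa using this
    · intro k
      refine ⟨smul_ne_zero (by positivity) hx, ?_⟩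
      rw [errorVec_smul, hxy, smul_zero, norm_zero]
      positivity
  · push Not at hex
    intro hfin
    obtain ⟨ε, hε, hle⟩ := exists_pos_le_of_finite hfin (fun p => ‖errorVec Θ p.1 p.2‖)
      (fun p hp => norm_pos_iff.2 (hex _ _ hp.1))
    obtain ⟨x, y, hx, hlt, hxy⟩ := h ε hε
    exact hlt.not_ge (hle (x, y) ⟨hx, hxy⟩)

theorem exists_of_lt_individualExponent {γ : ℝ} (hγ0 : 0 < γ)
    (hγ : (γ : EReal) < individualExponent Θ) (R : ℝ) :
    ∃ x y, x ≠ 0 ∧ R < ‖x‖ ∧ ‖errorVec Θ x y‖ ≤ ‖x‖ ^ (-γ) := by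
  obtain ⟨_, ⟨γ', rfl, hinf⟩, hlt⟩ := lt_sSup_iff.1 hγ
  have hlt' : γ < γ' := EReal.coe_lt_coe_iff.1 hlt
  -- The chosen pair has error at most `1`, so lying outside the finite set means `R < ‖x‖`.
  obtain ⟨⟨x, y⟩, ⟨hx, hxy⟩, hnot⟩ := (hinf.sdiff (finite_pairs Θ R)).nonempty
  have h1 := one_le_norm hx
  have h2 : ‖x‖ ^ (-γ') ≤ ‖x‖ ^ (-γ) := Real.rpow_le_rpow_of_exponent_le h1 (by linarith)
  have h3 : ‖x‖ ^ (-γ) ≤ 1 := Real.rpow_le_one_of_one_le_of_nonpos h1 (by linarith)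
  refine ⟨x, y, hx, ?_, hxy.trans h2⟩
  by_contra! hR
  exact hnot ⟨hR, hxy.trans (h2.trans h3)⟩

/-- A pair of integer vectors whose coordinates are jointly coprime. -/
def IsPrimitivePair (x : Fin m → ℤ) (y : Fin n → ℤ) : Prop :=
  ∃ (a : Fin m → ℤ) (b : Fin n → ℤ), a ⬝ᵥ x + b ⬝ᵥ y = 1

theorem exists_primitivePair {x : Fin m → ℤ} (y : Fin n → ℤ) (hx : x ≠ 0) :
    ∃ (g : ℤ) (x' : Fin m → ℤ) (y' : Fin n → ℤ), g ≠ 0 ∧ x = g • x' ∧ y = g • y' ∧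
      IsPrimitivePair x' y' := by
  set I : Ideal ℤ := Ideal.span (Set.range x) ⊔ Ideal.span (Set.range y) with hI
  obtain ⟨g, hg⟩ := (IsPrincipalIdealRing.principal I).principal
  have hx' : ∀ j, ∃ z, x j = g * z := fun j => by
    have : x j ∈ I := Ideal.mem_sup_left (Ideal.subset_span ⟨j, rfl⟩)
    rw [hg] at this
    exact Ideal.mem_span_singleton.1 this
  have hy' : ∀ j, ∃ z, y j = g * z := fun j => by
    have : y j ∈ I := Ideal.mem_sup_right (Ideal.subset_span ⟨j, rfl⟩)
    rw [hg] at this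
    exact Ideal.mem_span_singleton.1 this
  choose x' hx' using hx'
  choose y' hy' using hy'
  have hg0 : g ≠ 0 := by
    rintro rfl
    exact hx (funext fun j => by simp [hx'])
  have hgI : g ∈ I := by rw [hg]; exact Ideal.mem_span_singleton_self g
  obtain ⟨u, hu, v, hv, huv⟩ := Submodule.mem_sup.1 hgI
  obtain ⟨a, ha⟩ := (Submodule.mem_span_range_iff_exists_fun ℤ).1 hu
  obtain ⟨b, hb⟩ := (Submodule.mem_span_range_iff_exists_fun ℤ).1 hv
  refine ⟨g, x', y', hg0, funext hx', funext hy', a, b, mul_left_cancel₀ hg0 ?_⟩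
  have hab : g * (a ⬝ᵥ x' + b ⬝ᵥ y') = u + v := by
    rw [← ha, ← hb, mul_add, dotProduct, dotProduct, Finset.mul_sum, Finset.mul_sum]
    congr 1
    · refine Finset.sum_congr rfl fun j _ => ?_
      rw [smul_eq_mul, hx']; ring
    · refine Finset.sum_congr rfl fun j _ => ?_
      rw [smul_eq_mul, hy']; ring
  rw [hab, huv, mul_one]

/-- A pair which is proportional to a primitive pair is an integer multiple of it. -/
theorem IsPrimitivePair.exists_int {x₁ x₂ : Fin m → ℤ} {y₁ y₂ : Fin n → ℤ}
    (h : IsPrimitivePair x₁ y₁) {r : ℝ} (hx : ∀ j, (x₂ j : ℝ) = r * x₁ j)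
    (hu : errorVec Θ x₂ y₂ = r • errorVec Θ x₁ y₁) : ∃ z : ℤ, r = z := by
  have hy : ∀ i, (y₂ i : ℝ) = r * y₁ i := by
    intro i
    have hx' : (fun j => (x₂ j : ℝ)) = r • fun j => (x₁ j : ℝ) := funext fun j => by simp [hx]
    have := congrFun hu i
    simp only [errorVec, hx', Matrix.mulVec_smul, Pi.sub_apply, Pi.smul_apply, smul_eq_mul] at this
    linarith
  obtain ⟨a, b, hab⟩ := h
  refine ⟨a ⬝ᵥ x₂ + b ⬝ᵥ y₂, ?_⟩
  have hab' : (∑ j, (a j : ℝ) * x₁ j) + ∑ i, (b i : ℝ) * y₁ i = 1 := by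
    exact_mod_cast hab
  simp only [dotProduct, Int.cast_add, Int.cast_sum, Int.cast_mul, hx, hy]
  calc r = r * ((∑ j, (a j : ℝ) * x₁ j) + ∑ i, (b i : ℝ) * y₁ i) := by rw [hab', mul_one]
    _ = _ := by
      rw [mul_add, Finset.mul_sum, Finset.mul_sum]
      congr 1 <;> exact Finset.sum_congr rfl fun _ _ => by ring

theorem norm_eq_of_proportional {x₁ x₂ : Fin m → ℤ} {r : ℝ}
    (hx : ∀ j, (x₂ j : ℝ) = r * x₁ j) : ‖x₂‖ = |r| * ‖x₁‖ := by
  rw [← norm_int_cast x₂, ← norm_int_cast x₁, ← Real.norm_eq_abs, ← norm_smul]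
  congr 1
  exact funext fun j => by simp [hx]

/-- Dividing by the gcd shrinks both the size and the error, so the exponent survives. The size
stays above `R` because, without exact solutions, a tiny error needs a large `x`. -/
theorem exists_primitive_of_lt_individualExponent (hΘ : ∀ x y, x ≠ 0 → errorVec Θ x y ≠ 0)
    {γ : ℝ} (hγ0 : 0 < γ) (hγ : (γ : EReal) < individualExponent Θ) (R : ℝ) :
    ∃ x y, x ≠ 0 ∧ R < ‖x‖ ∧ ‖errorVec Θ x y‖ ≤ ‖x‖ ^ (-γ) ∧ IsPrimitivePair x y := by
  obtain ⟨ε, hε, hR⟩ := exists_eps_norm_gt Θ hΘ R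
  have hlim : ∀ᶠ t : ℝ in atTop, t ^ (-γ) < ε :=
    (tendsto_rpow_neg_atTop hγ0).eventually (gt_mem_nhds hε)
  obtain ⟨T, hT⟩ := eventually_atTop.1 hlim
  obtain ⟨x, y, hx, hTx, hxy⟩ := exists_of_lt_individualExponent Θ hγ0 hγ T
  obtain ⟨g, x', y', hg, rfl, rfl, hp⟩ := exists_primitivePair y hx
  have hx' : x' ≠ 0 := by rintro rfl; simp at hx
  have hg1 : (1 : ℝ) ≤ |(g : ℝ)| := by exact_mod_cast Int.one_le_abs hg
  have hle : ‖errorVec Θ x' y'‖ ≤ ‖errorVec Θ (g • x') (g • y')‖ := by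
    rw [errorVec_smul, norm_smul, Real.norm_eq_abs]
    exact le_mul_of_one_le_left (norm_nonneg _) hg1
  have hxle : ‖x'‖ ≤ ‖g • x'‖ := by
    rw [norm_eq_of_proportional (x₁ := x') (x₂ := g • x') (r := g) (fun j => by simp)]
    exact le_mul_of_one_le_left (norm_nonneg _) hg1
  refine ⟨x', y', hx', hR x' y' hx' (hle.trans_lt (hxy.trans_lt (hT _ hTx.le))), ?_, hp⟩
  refine (hle.trans hxy).trans ?_
  exact Real.rpow_le_rpow_of_nonpos (zero_lt_one.trans_le (one_le_norm hx')) hxle (by linarith)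

theorem eventually_of_lt_uniformExponent {a : ℝ} (ha : (a : EReal) < uniformExponent Θ) :
    ∀ᶠ t : ℝ in atTop, ∃ (x : Fin m → ℤ) (y : Fin n → ℤ),
      x ≠ 0 ∧ ‖x‖ ≤ t ∧ ‖errorVec Θ x y‖ ≤ t ^ (-a) := by
  obtain ⟨_, ⟨a', rfl, hev⟩, hlt⟩ := lt_sSup_iff.1 ha
  have hlt' : a < a' := EReal.coe_lt_coe_iff.1 hlt
  filter_upwards [hev, eventually_ge_atTop 1] with t ⟨x, y, hx, hxt, hxy⟩ ht
  exact ⟨x, y, norm_pos_iff.1 hx, hxt,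
    hxy.trans (Real.rpow_le_rpow_of_exponent_le ht (by linarith))⟩

theorem uniformExponent_eq_top {x : Fin m → ℤ} {y : Fin n → ℤ} (hx : x ≠ 0)
    (hxy : errorVec Θ x y = 0) : uniformExponent Θ = ⊤ := by
  rw [EReal.eq_top_iff_forall_lt]
  intro r
  refine lt_of_lt_of_le (EReal.coe_lt_coe_iff.2 (lt_add_one r)) (le_sSup ⟨r + 1, rfl, ?_⟩)
  filter_upwards [eventually_ge_atTop ‖x‖] with t ht
  refine ⟨x, y, norm_pos_iff.2 hx, ht, ?_⟩
  rw [hxy, norm_zero]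
  exact Real.rpow_nonneg ((norm_nonneg _).trans ht) _

/-- A consequence of Dirichlet's approximation theorem. -/
theorem coe_le_uniformExponent {δ : ℝ} (hδ : 0 < δ) (hδm : δ * n < m) :
    (δ : EReal) ≤ uniformExponent Θ := by
  refine le_sSup ⟨δ, rfl, ?_⟩
  filter_upwards [eventually_gt_atTop 1] with t ht
  have ht0 : 0 < t := zero_lt_one.trans ht
  set s : ℝ := t ^ (-δ) with hs
  have hs0 : 0 < s := Real.rpow_pos_of_pos ht0 _
  have hs1 : s < 1 := Real.rpow_lt_one_of_one_lt_of_neg ht (by linarith)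
  set M : Matrix (Fin m ⊕ Fin n) (Fin m ⊕ Fin n) ℝ :=
    Matrix.fromBlocks (t⁻¹ • 1) 0 (s⁻¹ • Θ) ((-s⁻¹) • 1) with hM
  have hdet : |M.det| = (t ^ m * s ^ n)⁻¹ := by
    rw [hM, Matrix.det_fromBlocks_zero₁₂, Matrix.det_smul, Matrix.det_smul]
    simp [abs_mul, abs_of_pos ht0, abs_of_pos hs0, mul_comm]
  have hpos : 0 < (t ^ m * s ^ n)⁻¹ := by positivity
  -- The exponent of `t` is `m - δ * n`, which is positive.
  have hvol : 1 < t ^ m * s ^ n := by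
    rw [hs, ← Real.rpow_natCast, ← Real.rpow_natCast, ← Real.rpow_mul ht0.le,
      ← Real.rpow_add ht0]
    exact Real.one_lt_rpow ht (by linarith)
  obtain ⟨w, hw, h⟩ := exists_int_mulVec_lt_one M (by rw [← abs_pos, hdet]; exact hpos)
    (by rw [hdet]; exact inv_lt_one_of_one_lt₀ hvol)
  set x := w ∘ Sum.inl with hx
  set y := w ∘ Sum.inr with hy
  have hxk : ∀ j, |(x j : ℝ)| < t := by
    intro j
    have := h (Sum.inl j)
    rw [hM, Matrix.fromBlocks_mulVec] at this
    simp only [Sum.elim_inl, Matrix.zero_mulVec, add_zero, Matrix.smul_mulVec, Matrix.one_mulVec,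
      Pi.smul_apply, smul_eq_mul, abs_mul, abs_of_pos (inv_pos.2 ht0)] at this
    rw [inv_mul_lt_iff₀ ht0, mul_one] at this
    exact this
  have hek : ∀ i, |errorVec Θ x y i| < s := by
    intro i
    have := h (Sum.inr i)
    have heq : M.mulVec (fun i => (w i : ℝ)) (Sum.inr i) = s⁻¹ * errorVec Θ x y i := by
      rw [hM, Matrix.fromBlocks_mulVec]
      simp only [Sum.elim_inr, Matrix.smul_mulVec, Matrix.one_mulVec, Pi.add_apply,
        Pi.smul_apply, smul_eq_mul, errorVec, Pi.sub_apply, Function.comp_def, hx, hy]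
      ring
    rw [heq, abs_mul, abs_of_pos (inv_pos.2 hs0), inv_mul_lt_iff₀ hs0, mul_one] at this
    exact this
  refine ⟨x, y, ?_, ?_, ?_⟩
  · rw [norm_pos_iff]
    intro hx0
    apply hw
    ext k
    rcases k with j | i
    · exact congrFun hx0 j
    · have := (hek i).trans hs1
      rw [hx0] at this
      simp only [errorVec, Pi.zero_apply, Int.cast_zero, Pi.sub_apply, abs_sub_comm] at this
      have h0 : Θ.mulVec (fun _ => (0 : ℝ)) i = 0 := by
        simp [Matrix.mulVec, dotProduct]
      rw [h0, sub_zero] at this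
      have h1 : |y i| < 1 := by exact_mod_cast this
      exact Int.abs_lt_one_iff.1 h1
  · rw [← norm_int_cast, pi_norm_le_iff_of_nonneg ht0.le]
    exact fun j => (hxk j).le
  · rw [pi_norm_le_iff_of_nonneg hs0.le]
    exact fun i => (hek i).le

/-- Dirichlet's value `m / n` is not needed: positivity suffices to make the inverse exponents
meaningful and to dispose of negative bounds. -/
theorem uniformExponent_pos (hm : 1 ≤ m) : 0 < uniformExponent Θ := by
  have hm' : (1 : ℝ) ≤ m := by exact_mod_cast hm
  have hn : (0 : ℝ) ≤ n := Nat.cast_nonneg n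
  have h : (0 : ℝ) < 1 / (n + 1) := by positivity
  refine lt_of_lt_of_le (EReal.coe_pos.2 h) (coe_le_uniformExponent Θ h ?_)
  rw [one_div_mul_eq_div, div_lt_iff₀ (by positivity)]
  nlinarith

theorem uniformExponent_le_individualExponent (hm : 1 ≤ m) :
    uniformExponent Θ ≤ individualExponent Θ := by
  refine le_of_forall_lt fun c hc => ?_
  obtain ⟨a, hca, ha⟩ :=
    EReal.lt_iff_exists_real_btwn.1 (max_lt hc (uniformExponent_pos Θ hm))
  refine lt_of_lt_of_le ((le_max_left _ _).trans_lt hca)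
    (le_individualExponent_of_forall_exists Θ fun ε hε => ?_)
  have ha0 : 0 < a := EReal.coe_pos.1 ((le_max_right _ _).trans_lt hca)
  obtain ⟨t, ⟨x, y, hx, hxt, hxy⟩, ht⟩ := ((eventually_of_lt_uniformExponent Θ ha).and
    ((tendsto_rpow_neg_atTop ha0).eventually (gt_mem_nhds hε))).exists
  refine ⟨x, y, hx, hxy.trans_lt ht, hxy.trans ?_⟩
  exact Real.rpow_le_rpow_of_nonpos (zero_lt_one.trans_le (one_le_norm hx)) hxt (by linarith)

end

/-! ### Choice of the box as powers of a parameter -/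

section

variable {n m : ℕ} (Θ : Matrix (Fin n) (Fin m) ℝ)

/-- If `ᵗΘ` admits approximations of size `C Y` and error `C V` with `V = κ R ^ (-N / k)` and
`Y = κ R ^ (D / k)` for arbitrarily large `R`, its exponent is at least every `γ` with
`γ D < N`. -/
theorem le_individualExponent_of_scale {C κ k N D γ : ℝ} (hC : 0 < C) (hκ : 0 < κ) (hk : 0 < k)
    (hN : 0 < N) (hγ : 0 ≤ γ) (hlt : γ * D < N)
    (h : ∃ᶠ R : ℝ in atTop, ∃ x y, ¬ (x = 0 ∧ y = 0) ∧ ‖x‖ ≤ C * (κ * R ^ (D / k)) ∧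
      ‖errorVec Θ x y‖ ≤ C * (κ * R ^ (-(N / k)))) :
    (γ : EReal) ≤ individualExponent Θ := by
  refine le_individualExponent_of_forall_exists Θ fun ε hε => ?_
  have h1 : Tendsto (fun R : ℝ => C * (κ * R ^ (-(N / k)))) atTop (𝓝 0) := by
    simpa using ((tendsto_rpow_neg_atTop (div_pos hN hk)).const_mul κ).const_mul C
  have h2 : Tendsto (fun R : ℝ => C * κ * (C * κ) ^ γ * R ^ (-((N - γ * D) / k))) atTop (𝓝 0) := by
    simpa using (tendsto_rpow_neg_atTop (div_pos (sub_pos.2 hlt) hk)).const_mul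
      (C * κ * (C * κ) ^ γ)
  obtain ⟨R, ⟨x, y, hne, hx, hxy⟩, hR1, hR2, hR0⟩ := (h.and_eventually
    ((h1.eventually (gt_mem_nhds (lt_min hε one_pos))).and
      ((h2.eventually (gt_mem_nhds one_pos)).and (eventually_gt_atTop 0)))).exists
  -- If `x = 0`, the error is the norm of a nonzero integer vector, hence at least `1`.
  have hx0 : x ≠ 0 := by
    rintro rfl
    have hy : y ≠ 0 := fun hy => hne ⟨rfl, hy⟩
    have h3 : errorVec Θ 0 y = -fun i => (y i : ℝ) := by
      have h0 : Θ.mulVec (fun _ => (0 : ℝ)) = 0 := by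
        ext i
        simp [Matrix.mulVec, dotProduct]
      simp [errorVec, h0]
    rw [h3, norm_neg, norm_int_cast] at hxy
    exact ((one_le_norm hy).trans hxy).not_gt (hR1.trans_le (min_le_right _ _))
  refine ⟨x, y, hx0, (hxy.trans_lt hR1).trans_le (min_le_left _ _), hxy.trans ?_⟩
  have hxpos : 0 < ‖x‖ := norm_pos_iff.2 hx0
  have hY : 0 < C * (κ * R ^ (D / k)) := by positivity
  refine le_trans ?_ (Real.rpow_le_rpow_of_nonpos hxpos hx (by linarith))
  rw [Real.rpow_neg hY.le, ← one_div, le_div_iff₀ (Real.rpow_pos_of_pos hY _)]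
  refine le_of_eq_of_le ?_ hR2.le
  rw [← mul_assoc C κ (R ^ (D / k)), Real.mul_rpow (by positivity) (by positivity),
    ← Real.rpow_mul hR0.le,
    show -((N - γ * D) / k) = -(N / k) + D / k * γ by field_simp; ring, Real.rpow_add hR0]
  ring

theorem le_transpose_exponent_of_one {p q c γ : ℝ} (hn : 1 ≤ n) (hm : 1 ≤ m) (hc : 0 < c)
    (hγ : 0 ≤ γ)
    (hN : 0 < n * q + (n - 1) * p)
    (hlt : γ * ((m - 1) * q + m * p) < n * q + (n - 1) * p)
    (h : ∃ᶠ R : ℝ in atTop, ∃ x y, x ≠ 0 ∧ ‖x‖ ≤ c * R ^ p ∧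
      ‖errorVec Θ x y‖ ≤ c * R ^ (-q)) :
    (γ : EReal) ≤ individualExponent Θ.transpose := by
  have hn' : (1 : ℝ) ≤ n := by exact_mod_cast hn
  have hm' : (1 : ℝ) ≤ m := by exact_mod_cast hm
  -- With `Y / V = R ^ (p + q)` both kinds of coefficients get the same bound `A`; equality of the
  -- powers of `R` in `A` and `V ^ m * Y ^ n` then determines `N / k` and `D / k`.
  set N : ℝ := n * q + (n - 1) * p with hNdef
  set D : ℝ := (m - 1) * q + m * p with hDdef
  set k : ℝ := m + n - 1 with hk
  have hk0 : 0 < k := by rw [hk]; linarith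
  have hND : N / k + D / k = p + q := by
    rw [← add_div, div_eq_iff hk0.ne', hNdef, hDdef, hk]; ring
  set κ : ℝ := c + 1 with hκ
  have hκ0 : 0 < κ := by positivity
  have hC : (0 : ℝ) < ((m + n : ℕ) : ℝ) ^ 2 := by
    have : 0 < m + n := by omega
    positivity
  refine le_individualExponent_of_scale Θ.transpose hC hκ0 hk0 hN hγ hlt ?_
  refine (h.and_eventually (eventually_gt_atTop 0)).mono ?_
  rintro R ⟨⟨x, y, hx, hxR, huR⟩, hR0⟩
  have hV : 0 < κ * R ^ (-(N / k)) := by positivity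
  have hY : 0 < κ * R ^ (D / k) := by positivity
  have hYV : κ * R ^ (D / k) = κ * R ^ (-(N / k)) * R ^ (p + q) := by
    rw [mul_assoc, ← Real.rpow_add hR0]
    congr 2
    linarith
  refine exists_transpose_approx Θ hV hY x y hx (A := κ * R ^ (-(N / k)) * (c * R ^ p)) ?_ ?_ ?_
  · gcongr
  · calc κ * R ^ (D / k) * ‖errorVec Θ x y‖ ≤ κ * R ^ (D / k) * (c * R ^ (-q)) := by gcongr
      _ = κ * R ^ (-(N / k)) * (c * (R ^ (p + q) * R ^ (-q))) := by rw [hYV]; ring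
      _ = _ := by rw [← Real.rpow_add hR0]; congr 4; ring
  · have h1 : κ * R ^ (-(N / k)) * (c * R ^ p) = κ * c * R ^ (-(N / k) + p) := by
      rw [Real.rpow_add hR0]; ring
    have h2 : (κ * R ^ (-(N / k))) ^ m * (κ * R ^ (D / k)) ^ n =
        κ ^ (m + n) * R ^ (-(N / k) + p) := by
      rw [mul_pow, mul_pow, ← Real.rpow_mul_natCast hR0.le, ← Real.rpow_mul_natCast hR0.le,
        mul_mul_mul_comm, ← pow_add, ← Real.rpow_add hR0]
      congr 2
      have : D / k = p + q - N / k := by linarith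
      rw [this]
      have : N / k * k = N := div_mul_cancel₀ _ hk0.ne'
      rw [hk, hNdef] at this
      rw [← hNdef] at this
      linarith
    rw [h1, h2]
    refine mul_lt_mul_of_pos_right ?_ (by positivity)
    calc κ * c < κ ^ 2 := by rw [sq]; gcongr; linarith
      _ ≤ κ ^ (m + n) := pow_le_pow_right₀ (by linarith) (by omega)

theorem le_transpose_exponent_of_two {p q e c γ : ℝ} (hn : 1 ≤ n) (hm : 1 ≤ m)
    (hnm : ¬ (n = 1 ∧ m = 1)) (hc : 0 < c) (hγ : 0 ≤ γ)
    (hN : 0 < (n - 1) * (p + q) + (q - e))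
    (hlt : γ * ((m - 1) * (p + q) - (q - e)) < (n - 1) * (p + q) + (q - e))
    (h : ∃ᶠ R : ℝ in atTop, ∃ x₁ y₁ x₂ y₂, x₁ ≠ 0 ∧
      (∀ r : ℝ, ¬ ((∀ j, (x₂ j : ℝ) = r * x₁ j) ∧ errorVec Θ x₂ y₂ = r • errorVec Θ x₁ y₁)) ∧
      ‖x₁‖ ≤ c * R ^ p ∧ ‖errorVec Θ x₁ y₁‖ ≤ c * R ^ (-q) ∧
      ‖x₂‖ ≤ c * R ^ e ∧ ‖errorVec Θ x₂ y₂‖ ≤ c * R ^ (e - p - q)) :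
    (γ : EReal) ≤ individualExponent Θ.transpose := by
  have hn' : (1 : ℝ) ≤ n := by exact_mod_cast hn
  have hm' : (1 : ℝ) ≤ m := by exact_mod_cast hm
  have hmn : 3 ≤ m + n := by omega
  have hmn' : (3 : ℝ) ≤ m + n := by exact_mod_cast hmn
  set N : ℝ := (n - 1) * (p + q) + (q - e) with hNdef
  set D : ℝ := (m - 1) * (p + q) - (q - e) with hDdef
  set k : ℝ := m + n - 2 with hk
  have hk0 : 0 < k := by rw [hk]; linarith
  have hND : N / k + D / k = p + q := by
    rw [← add_div, div_eq_iff hk0.ne', hNdef, hDdef, hk]; ring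
  -- The powers of `R` balance, so only `κ ^ 2 * (2 * c ^ 2) < κ ^ (m + n)` remains; this works
  -- since `m + n ≥ 3`.
  set κ : ℝ := 2 * c ^ 2 + 1 with hκ
  have hκ0 : 0 < κ := by positivity
  have hκ1 : 1 ≤ κ := by rw [hκ]; nlinarith
  have hC : (0 : ℝ) < ((m + n : ℕ) : ℝ) ^ 2 := by
    have : 0 < m + n := by omega
    positivity
  refine le_individualExponent_of_scale Θ.transpose hC hκ0 hk0 hN hγ hlt ?_
  refine (h.and_eventually (eventually_gt_atTop 0)).mono ?_
  rintro R ⟨⟨x₁, y₁, x₂, y₂, hx, hind, hx₁, hu₁, hx₂, hu₂⟩, hR0⟩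
  have hV : 0 < κ * R ^ (-(N / k)) := by positivity
  have hY : 0 < κ * R ^ (D / k) := by positivity
  have hYV : κ * R ^ (D / k) = κ * R ^ (-(N / k)) * R ^ (p + q) := by
    rw [mul_assoc, ← Real.rpow_add hR0]
    congr 2
    linarith
  refine exists_transpose_approx_of_two Θ hV hY x₁ x₂ y₁ y₂ hx hind
    (A := κ * R ^ (-(N / k)) * (c * R ^ p)) (B := κ * R ^ (-(N / k)) * (c * R ^ e)) ?_ ?_ ?_ ?_ ?_
  · gcongr
  · calc κ * R ^ (D / k) * ‖errorVec Θ x₁ y₁‖ ≤ κ * R ^ (D / k) * (c * R ^ (-q)) := by gcongr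
      _ = κ * R ^ (-(N / k)) * (c * (R ^ (p + q) * R ^ (-q))) := by rw [hYV]; ring
      _ = _ := by rw [← Real.rpow_add hR0]; congr 4; ring
  · gcongr
  · calc κ * R ^ (D / k) * ‖errorVec Θ x₂ y₂‖ ≤ κ * R ^ (D / k) * (c * R ^ (e - p - q)) := by
          gcongr
      _ = κ * R ^ (-(N / k)) * (c * (R ^ (p + q) * R ^ (e - p - q))) := by rw [hYV]; ring
      _ = _ := by rw [← Real.rpow_add hR0]; congr 4; ring
  · have h1 : 2 * (κ * R ^ (-(N / k)) * (c * R ^ p)) * (κ * R ^ (-(N / k)) * (c * R ^ e)) =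
        κ ^ 2 * (2 * c ^ 2) * R ^ (-(N / k) + -(N / k) + (p + e)) := by
      rw [Real.rpow_add hR0, Real.rpow_add hR0, Real.rpow_add hR0]; ring
    have h2 : (κ * R ^ (-(N / k))) ^ m * (κ * R ^ (D / k)) ^ n =
        κ ^ (m + n) * R ^ (-(N / k) + -(N / k) + (p + e)) := by
      rw [mul_pow, mul_pow, ← Real.rpow_mul_natCast hR0.le, ← Real.rpow_mul_natCast hR0.le,
        mul_mul_mul_comm, ← pow_add, ← Real.rpow_add hR0]
      congr 2
      have hD : D / k = p + q - N / k := by linarith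
      rw [hD]
      have : N / k * (m + n - 2) = (n - 1) * (p + q) + (q - e) :=
        div_mul_cancel₀ _ hk0.ne'
      linarith
    rw [h1, h2]
    refine mul_lt_mul_of_pos_right ?_ (by positivity)
    calc κ ^ 2 * (2 * c ^ 2) < κ ^ 2 * κ := by gcongr; linarith
      _ = κ ^ 3 := by ring
      _ ≤ κ ^ (m + n) := pow_le_pow_right₀ hκ1 hmn

end

/-! ### Parameters for the individual bounds -/

section

variable {n m : ℕ} (Θ : Matrix (Fin n) (Fin m) ℝ)

theorem le_transpose_exponent_of_lt_individual {g γ : ℝ} (hn : 1 ≤ n) (hm : 1 ≤ m)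
    (hg0 : 0 < g) (hg : (g : EReal) < individualExponent Θ) (hγ : 0 ≤ γ)
    (hN : 0 < n * g + n - 1) (hlt : γ * ((m - 1) * g + m) < n * g + n - 1) :
    (γ : EReal) ≤ individualExponent Θ.transpose := by
  refine le_transpose_exponent_of_one Θ (p := 1) (q := g) hn hm one_pos hγ (by linarith)
    (by linarith) (frequently_atTop.2 fun R => ?_)
  obtain ⟨x, y, hx, hR, hxy⟩ := exists_of_lt_individualExponent Θ hg0 hg R
  exact ⟨‖x‖, hR.le, x, y, hx, by simp, by simpa using hxy⟩

theorem le_transpose_exponent_of_lt_uniform_individual {a g γ : ℝ} (hn : 1 ≤ n) (hm : 1 ≤ m)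
    (hnm : ¬ (n = 1 ∧ m = 1)) (hΘ : ∀ x y, x ≠ 0 → errorVec Θ x y ≠ 0)
    (ha0 : 0 < a) (hag : a ≤ g) (ha : (a : EReal) < uniformExponent Θ)
    (hg : (g : EReal) < individualExponent Θ) (hγ : 0 ≤ γ)
    (hN : 0 < (n - 1) * (1 + g) - (1 - a))
    (hlt : γ * ((m - 1) * (1 + g) + (1 - a)) < (n - 1) * (1 + g) - (1 - a)) :
    (γ : EReal) ≤ individualExponent Θ.transpose := by
  refine le_transpose_exponent_of_two Θ (p := 1) (q := g) (e := 1 + g - a) (c := 2 ^ a) hn hm hnm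
    (by positivity) hγ (by linarith) (by linarith) (frequently_atTop.2 fun R₀ => ?_)
  have hhalf : Tendsto (fun R : ℝ => R / 2) atTop atTop := tendsto_id.atTop_div_const two_pos
  obtain ⟨R₁, hR₁⟩ := eventually_atTop.1
    (hhalf.eventually (eventually_of_lt_uniformExponent Θ ha))
  obtain ⟨x₁, y₁, hx₁, hR, hu₁, hp⟩ :=
    exists_primitive_of_lt_individualExponent Θ hΘ (ha0.trans_le hag) hg (max R₀ R₁)
  -- At `t = ‖x₁‖ / 2` the second vector is too short to be a nonzero integer multiple of `x₁`. Its
  -- error, about `‖x₁‖ ^ (-a)`, dictates `e = 1 + g - a`; the bound on `‖x₂‖` then has room because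
  -- `a ≤ g`.
  obtain ⟨x₂, y₂, hx₂, hxt, hu₂⟩ := hR₁ ‖x₁‖ ((le_max_right _ _).trans hR.le)
  have h1 : 1 ≤ ‖x₁‖ := one_le_norm hx₁
  have hc : (1 : ℝ) ≤ 2 ^ a := Real.one_le_rpow one_le_two ha0.le
  refine ⟨‖x₁‖, (le_max_left _ _).trans hR.le, x₁, y₁, x₂, y₂, hx₁, ?_, ?_, ?_, ?_, ?_⟩
  · rintro r ⟨hx, hu⟩
    obtain ⟨z, rfl⟩ := hp.exists_int Θ hx hu
    have hz : z ≠ 0 := by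
      rintro rfl
      exact hx₂ (funext fun j => by simpa using hx j)
    have hz1 : (1 : ℝ) ≤ |(z : ℝ)| := by exact_mod_cast Int.one_le_abs hz
    have := norm_eq_of_proportional hx
    nlinarith
  · rw [Real.rpow_one]
    exact le_mul_of_one_le_left (norm_nonneg _) hc
  · exact hu₁.trans (le_mul_of_one_le_left (by positivity) hc)
  · calc ‖x₂‖ ≤ ‖x₁‖ := by linarith
      _ ≤ ‖x₁‖ ^ (1 + g - a) := by
        simpa using Real.rpow_le_rpow_of_exponent_le h1 (by linarith : (1 : ℝ) ≤ 1 + g - a)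
      _ ≤ _ := le_mul_of_one_le_left (by positivity) hc
  · refine hu₂.trans_eq ?_
    rw [div_eq_mul_inv, Real.mul_rpow (by positivity) (by positivity), Real.inv_rpow two_pos.le,
      Real.rpow_neg two_pos.le, inv_inv, mul_comm]
    congr 2
    ring

theorem le_transpose_exponent_of_lt_inv {a b γ : ℝ} (hn : 1 ≤ n) (hm : 1 ≤ m)
    (hnm : ¬ (n = 1 ∧ m = 1)) (hΘ : ∀ x y, x ≠ 0 → errorVec Θ x y ≠ 0)
    (hb0 : 0 < b) (hba : b ≤ a) (ha : ((a⁻¹ : ℝ) : EReal) < uniformExponent Θ)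
    (hb : ((b⁻¹ : ℝ) : EReal) < individualExponent Θ) (hγ : 0 ≤ γ)
    (hN : 0 < (n - 1) * (1 + b) - (a - 1))
    (hlt : γ * ((m - 1) * (1 + b) + (a - 1)) < (n - 1) * (1 + b) - (a - 1)) :
    (γ : EReal) ≤ individualExponent Θ.transpose := by
  have ha0 : 0 < a := hb0.trans_le hba
  refine le_transpose_exponent_of_two Θ (p := b) (q := 1) (e := a) (c := 2 ^ a) hn hm hnm
    (by positivity) hγ (by linarith) (by linarith) (frequently_atTop.2 fun R₀ => ?_)
  have hT : Tendsto (fun R : ℝ => (2 * R) ^ a) atTop atTop :=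
    (tendsto_rpow_atTop ha0).comp (tendsto_id.const_mul_atTop two_pos)
  obtain ⟨R₁, hR₁⟩ := eventually_atTop.1 (hT.eventually (eventually_of_lt_uniformExponent Θ ha))
  obtain ⟨T, hT⟩ := eventually_atTop.1 ((tendsto_rpow_atTop (inv_pos.2 hb0)).eventually
    (eventually_ge_atTop (max (max R₀ R₁) 1)))
  obtain ⟨x₁, y₁, hx₁, hTx, hu₁, hp⟩ :=
    exists_primitive_of_lt_individualExponent Θ hΘ (inv_pos.2 hb0) hb T
  have hU : 0 < ‖errorVec Θ x₁ y₁‖ := norm_pos_iff.2 (hΘ _ _ hx₁)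
  -- Here the scale is the inverse error rather than the size.
  set R : ℝ := ‖errorVec Θ x₁ y₁‖⁻¹ with hR
  have hR0 : 0 < R := inv_pos.2 hU
  have hUR : ‖errorVec Θ x₁ y₁‖ = R⁻¹ := (inv_inv _).symm
  have hxR : ‖x₁‖ ^ b⁻¹ ≤ R := by
    rw [hR, le_inv_comm₀ (Real.rpow_pos_of_pos (norm_pos_iff.2 hx₁) _) hU,
      ← Real.rpow_neg (norm_nonneg _)]
    exact hu₁
  have hRbig := (hT _ hTx.le).trans hxR
  have hR1 : 1 ≤ R := (le_max_right _ _).trans hRbig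
  -- At `t = (2 * R) ^ a` the second error is at most half the first, so it cannot come from a
  -- nonzero integer multiple. Now the size dictates `e = a`, and `b ≤ a` leaves room in the error.
  obtain ⟨x₂, y₂, hx₂, hxt, hu₂⟩ :=
    hR₁ R ((le_max_right _ _).trans ((le_max_left _ _).trans hRbig))
  have hu₂' : ‖errorVec Θ x₂ y₂‖ ≤ R⁻¹ / 2 := by
    refine hu₂.trans_eq ?_
    rw [← Real.rpow_mul (by positivity), mul_neg, mul_inv_cancel₀ ha0.ne', Real.rpow_neg_one,
      mul_inv]
    ring
  have hc : (1 : ℝ) ≤ 2 ^ a := Real.one_le_rpow one_le_two ha0.le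
  refine ⟨R, (le_max_left _ _).trans ((le_max_left _ _).trans hRbig), x₁, y₁, x₂, y₂, hx₁,
    ?_, ?_, ?_, ?_, ?_⟩
  · rintro r ⟨hx, hu⟩
    obtain ⟨z, rfl⟩ := hp.exists_int Θ hx hu
    have hz : z ≠ 0 := by
      rintro rfl
      exact hx₂ (funext fun j => by simpa using hx j)
    have hz1 : (1 : ℝ) ≤ |(z : ℝ)| := by exact_mod_cast Int.one_le_abs hz
    rw [hu, norm_smul, Real.norm_eq_abs, hUR] at hu₂'
    have : 0 < R⁻¹ := inv_pos.2 hR0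
    nlinarith
  · calc ‖x₁‖ = (‖x₁‖ ^ b⁻¹) ^ b := (Real.rpow_inv_rpow (norm_nonneg _) hb0.ne').symm
      _ ≤ R ^ b := Real.rpow_le_rpow (by positivity) hxR hb0.le
      _ ≤ _ := le_mul_of_one_le_left (by positivity) hc
  · rw [hUR, Real.rpow_neg_one]
    exact le_mul_of_one_le_left (by positivity) hc
  · rwa [Real.mul_rpow two_pos.le hR0.le] at hxt
  · calc ‖errorVec Θ x₂ y₂‖ ≤ R⁻¹ := hu₂'.trans (half_le_self (by positivity))
      _ = R ^ (-1 : ℝ) := (Real.rpow_neg_one R).symm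
      _ ≤ R ^ (a - b - 1) := Real.rpow_le_rpow_of_exponent_le hR1 (by linarith)
      _ ≤ _ := le_mul_of_one_le_left (by positivity) hc

/-- Two independent exact solutions serve at every scale: the vectors stay fixed while `R` grows, so
`p = e = 0`. -/
theorem le_transpose_exponent_of_exact {γ : ℝ} (hn : 1 ≤ n) (hm : 1 ≤ m)
    (hnm : ¬ (n = 1 ∧ m = 1)) {x₁ x₂ : Fin m → ℤ} (hx₁ : x₁ ≠ 0)
    (h₁ : x₁ ∈ exactSolutions Θ) (h₂ : x₂ ∈ exactSolutions Θ)
    (hind : ∀ r : ℝ, ¬ ∀ j, (x₂ j : ℝ) = r * x₁ j) (hγ : 0 ≤ γ)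
    (hlt : γ * (m - 2) < n) :
    (γ : EReal) ≤ individualExponent Θ.transpose := by
  have hn' : (1 : ℝ) ≤ n := by exact_mod_cast hn
  obtain ⟨y₁, hy₁⟩ := h₁
  obtain ⟨y₂, hy₂⟩ := h₂
  refine le_transpose_exponent_of_two Θ (p := 0) (q := 1) (e := 0) (c := ‖x₁‖ + ‖x₂‖) hn hm hnm
    ?_ hγ (by linarith) (by linarith) (Eventually.frequently ?_)
  · have := norm_pos_iff.2 hx₁
    positivity
  · filter_upwards [eventually_gt_atTop 0] with R hR
    refine ⟨x₁, y₁, x₂, y₂, hx₁, fun r hr => hind r hr.1, ?_, ?_, ?_, ?_⟩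
    · rw [Real.rpow_zero, mul_one]
      exact le_add_of_nonneg_right (norm_nonneg _)
    · rw [hy₁, norm_zero]
      positivity
    · rw [Real.rpow_zero, mul_one]
      exact le_add_of_nonneg_left (norm_nonneg _)
    · rw [hy₂, norm_zero]
      positivity

theorem exists_independent_exactSolution (h : Set.finrank ℤ (exactSolutions Θ) ≠ 1)
    {x₁ : Fin m → ℤ} (hx₁ : x₁ ≠ 0) (h₁ : x₁ ∈ exactSolutions Θ) :
    ∃ x₂ ∈ exactSolutions Θ, ∀ r : ℝ, ¬ ∀ j, (x₂ j : ℝ) = r * x₁ j := by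
  by_contra! hcon
  apply h
  obtain ⟨i, hi⟩ := Function.ne_iff.1 hx₁
  set L := Submodule.span ℤ (exactSolutions Θ) with hL
  -- This kernel consists of the `x` with `x₁ i • x = x i • x₁`, so the `i`-th coordinate is
  -- injective on it and the rank is at most one.
  have hle : L ≤ LinearMap.ker (x₁ i • (LinearMap.id : (Fin m → ℤ) →ₗ[ℤ] (Fin m → ℤ)) -
      (LinearMap.proj i).smulRight x₁) := by
    refine Submodule.span_le.2 fun x hx => ?_
    obtain ⟨r, hr⟩ := hcon x hx
    rw [SetLike.mem_coe, LinearMap.mem_ker]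
    ext j
    simp only [LinearMap.sub_apply, LinearMap.smul_apply, LinearMap.id_apply,
      LinearMap.smulRight_apply, LinearMap.proj_apply, Pi.sub_apply, Pi.smul_apply, smul_eq_mul,
      Pi.zero_apply]
    have : ((x₁ i * x j - x i * x₁ j : ℤ) : ℝ) = 0 := by
      push_cast
      rw [hr i, hr j]
      ring
    exact_mod_cast this
  have hinj : Function.Injective ((LinearMap.proj i).comp L.subtype : L →ₗ[ℤ] ℤ) := by
    rw [injective_iff_map_eq_zero]
    rintro ⟨x, hx⟩ hxi
    have hxi' : x i = 0 := hxi
    have := LinearMap.mem_ker.1 (hle hx)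
    simp only [LinearMap.sub_apply, LinearMap.smul_apply, LinearMap.id_apply,
      LinearMap.smulRight_apply, LinearMap.proj_apply, hxi', zero_smul, sub_zero] at this
    exact Subtype.ext ((smul_eq_zero.1 this).resolve_left hi)
  have hub : Module.finrank ℤ L ≤ 1 := by
    simpa using LinearMap.finrank_le_finrank_of_injective hinj
  have : Nontrivial L :=
    ⟨⟨⟨x₁, Submodule.subset_span h₁⟩, 0, fun h0 => hx₁ (congrArg Subtype.val h0)⟩⟩
  have hlb : 0 < Module.finrank ℤ L := Module.finrank_pos
  exact le_antisymm hub hlb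

end

/-! ### Extended-real limits and the three bounds -/

/-- The product form `γ * D < N` covers `D = 0` as well. Positivity of `N + D` forbids a positive
quotient of two negative numbers and makes `N` positive when `D = 0`; negative quotients are
harmless. -/
theorem quot_le {N D : ℝ} {β : EReal} (hβ : 0 ≤ β) (hND : 0 < N + D)
    (h : ∀ γ : ℝ, 0 ≤ γ → 0 < N → γ * D < N → (γ : EReal) ≤ β) : quot N D ≤ β := by
  unfold quot
  split_ifs with hD
  · have hN : 0 < N := by linarith
    rw [top_le_iff, EReal.eq_top_iff_forall_lt]
    intro r
    refine lt_of_lt_of_le ?_ (h (max r 0 + 1) (by positivity) hN (by rw [hD, mul_zero]; exact hN))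
    exact EReal.coe_lt_coe_iff.2 ((le_max_left r 0).trans_lt (lt_add_one _))
  · refine le_of_forall_lt fun c hc => ?_
    rcases lt_or_ge c 0 with h0 | h0
    · exact h0.trans_le hβ
    obtain ⟨g, hcg, hg⟩ := EReal.lt_iff_exists_real_btwn.1 hc
    have hg0 : 0 < g := EReal.coe_pos.1 (h0.trans_lt hcg)
    have hg' : g < N / D := EReal.coe_lt_coe_iff.1 hg
    have hpos : 0 < N / D := hg0.trans hg'
    rcases div_pos_iff.1 hpos with ⟨hN, hD⟩ | ⟨hN, hD⟩
    · exact hcg.trans_le (h g hg0.le hN ((lt_div_iff₀ hD).1 hg'))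
    · linarith

theorem inv_toReal_nonneg {x : EReal} (hx : 0 < x) : 0 ≤ (x⁻¹).toReal :=
  EReal.toReal_nonneg (EReal.inv_nonneg_of_nonneg hx.le)

theorem inv_toReal_anti {x y : EReal} (hx : 0 < x) (hxy : x ≤ y) :
    (y⁻¹).toReal ≤ (x⁻¹).toReal := by
  induction y with
  | bot => simp_all
  | top => simpa using inv_toReal_nonneg hx
  | coe y =>
    induction x with
    | bot => simp_all
    | top => simp_all
    | coe x =>
      rw [← EReal.coe_inv, ← EReal.coe_inv, EReal.toReal_coe, EReal.toReal_coe]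
      exact inv_anti₀ (EReal.coe_pos.1 hx) (EReal.coe_le_coe_iff.1 hxy)

theorem inv_inv_toReal_add_lt {x : EReal} (hx : 0 < x) {δ : ℝ} (hδ : 0 < δ) :
    ((((x⁻¹).toReal + δ)⁻¹ : ℝ) : EReal) < x := by
  induction x with
  | bot => simp_all
  | top => exact EReal.coe_lt_top _
  | coe x =>
    have hx' : 0 < x := EReal.coe_pos.1 hx
    rw [← EReal.coe_inv, EReal.toReal_coe, EReal.coe_lt_coe_iff]
    exact inv_lt_of_inv_lt₀ hx' (by linarith)

theorem exists_pos_lt_of_continuous {f g : ℝ → ℝ} (hf : Continuous f) (hg : Continuous g)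
    (hf0 : 0 < f 0) (hg0 : 0 < g 0) {ε : ℝ} (hε : 0 < ε) :
    ∃ δ, 0 < δ ∧ δ < ε ∧ 0 < f δ ∧ 0 < g δ := by
  have h1 : ∀ᶠ δ in 𝓝 (0 : ℝ), 0 < f δ := hf.continuousAt.eventually (lt_mem_nhds hf0)
  have h2 : ∀ᶠ δ in 𝓝 (0 : ℝ), 0 < g δ := hg.continuousAt.eventually (lt_mem_nhds hg0)
  have h3 : ∀ᶠ δ in 𝓝 (0 : ℝ), δ < ε := gt_mem_nhds hε
  obtain ⟨δ, ⟨hδ1, hδ2, hδ3⟩, hδ⟩ := (((h1.and (h2.and h3)).filter_mono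
    nhdsWithin_le_nhds).and (self_mem_nhdsWithin (s := Set.Ioi (0 : ℝ)))).exists
  exact ⟨δ, hδ, hδ3, hδ1, hδ2⟩

theorem eventually_affine_pos {s : ℝ} (hs : 0 < s) (r : ℝ) : ∀ᶠ t : ℝ in atTop, 0 < s * t + r :=
  (tendsto_atTop_add_const_right _ r (tendsto_id.const_mul_atTop hs)).eventually_gt_atTop 0

section

variable {n m : ℕ} (Θ : Matrix (Fin n) (Fin m) ℝ)

theorem bound₁_le (hn : 1 ≤ n) (hm : 1 ≤ m) :
    bound₁ n m (individualExponent Θ) ≤ individualExponent Θ.transpose := by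
  have hn' : (1 : ℝ) ≤ n := by exact_mod_cast hn
  have hm' : (1 : ℝ) ≤ m := by exact_mod_cast hm
  have hpos : 0 < individualExponent Θ :=
    (uniformExponent_pos Θ hm).trans_le (uniformExponent_le_individualExponent Θ hm)
  have hpos' : 0 < individualExponent Θ.transpose :=
    (uniformExponent_pos _ hn).trans_le (uniformExponent_le_individualExponent _ hn)
  unfold bound₁
  split_ifs with htop
  · refine quot_le hpos'.le (by linarith) fun γ hγ _ hlt => ?_
    -- The required inequality is affine in `g` with positive slope, so it holds for large `g`.
    obtain ⟨g, hg1, hg0⟩ := ((eventually_affine_pos (sub_pos.2 hlt) (n - 1 - γ * m)).and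
      (eventually_gt_atTop 0)).exists
    refine le_transpose_exponent_of_lt_individual Θ hn hm hg0 (htop ▸ EReal.coe_lt_top g) hγ
      ?_ (by linarith)
    nlinarith
  · obtain ⟨b, hb⟩ : ∃ b : ℝ, individualExponent Θ = b :=
      ⟨_, (EReal.coe_toReal htop hpos.ne_bot).symm⟩
    rw [hb] at hpos ⊢
    rw [EReal.toReal_coe]
    have hb0 : 0 < b := EReal.coe_pos.1 hpos
    refine quot_le hpos'.le (by nlinarith) fun γ hγ hN hlt => ?_
    obtain ⟨δ, hδ0, hδb, h1, h2⟩ := exists_pos_lt_of_continuous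
      (f := fun δ => n * (b - δ) + n - 1)
      (g := fun δ => n * (b - δ) + n - 1 - γ * ((m - 1) * (b - δ) + m))
      (by fun_prop) (by fun_prop) (by simpa using hN) (by simpa using hlt) hb0
    exact le_transpose_exponent_of_lt_individual Θ hn hm (sub_pos.2 hδb)
      (by rw [hb]; exact EReal.coe_lt_coe_iff.2 (by linarith)) hγ h1 (sub_pos.1 h2)

theorem bound₂_le (hn : 1 ≤ n) (hm : 1 ≤ m) (hnm : ¬ (n = 1 ∧ m = 1)) {a : ℝ}
    (ha : uniformExponent Θ = a) :
    bound₂ n m a (individualExponent Θ) ≤ individualExponent Θ.transpose := by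
  have hn' : (1 : ℝ) ≤ n := by exact_mod_cast hn
  have hm' : (1 : ℝ) ≤ m := by exact_mod_cast hm
  have hmn : (3 : ℝ) ≤ n + m := by exact_mod_cast (show 3 ≤ n + m by omega)
  have hapos := uniformExponent_pos Θ hm
  have hab := uniformExponent_le_individualExponent Θ hm
  have hpos : 0 < individualExponent Θ := hapos.trans_le hab
  have hpos' : 0 < individualExponent Θ.transpose :=
    (uniformExponent_pos _ hn).trans_le (uniformExponent_le_individualExponent _ hn)
  have hΘ : ∀ x y, x ≠ 0 → errorVec Θ x y ≠ 0 := fun x y hx hxy => by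
    have := uniformExponent_eq_top Θ hx hxy
    rw [ha] at this
    exact EReal.coe_ne_top _ this
  have ha0 : 0 < a := EReal.coe_pos.1 (ha ▸ hapos)
  unfold bound₂
  split_ifs with htop
  · refine quot_le hpos'.le (by linarith) fun γ hγ hN hlt => ?_
    -- Any positive number below `a` would do in place of `a / 2`, since its contribution is
    -- constant as `g` grows.
    obtain ⟨g, hg1, hg2, hg0⟩ := ((eventually_affine_pos (sub_pos.2 hlt)
      ((n - 1) - (1 - a / 2) - γ * ((m - 1) + (1 - a / 2)))).and
      ((eventually_affine_pos hN ((n - 1) - (1 - a / 2))).and (eventually_ge_atTop (a / 2)))).exists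
    exact le_transpose_exponent_of_lt_uniform_individual Θ hn hm hnm hΘ (half_pos ha0) hg0
      (by rw [ha]; exact EReal.coe_lt_coe_iff.2 (half_lt_self ha0))
      (htop ▸ EReal.coe_lt_top g) hγ (by linarith) (by linarith)
  · obtain ⟨b, hb⟩ : ∃ b : ℝ, individualExponent Θ = b :=
      ⟨_, (EReal.coe_toReal htop hpos.ne_bot).symm⟩
    rw [hb, EReal.toReal_coe]
    rw [ha, hb, EReal.coe_le_coe_iff] at hab
    refine quot_le hpos'.le (by nlinarith) fun γ hγ hN hlt => ?_
    obtain ⟨δ, hδ0, hδb, h1, h2⟩ := exists_pos_lt_of_continuous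
      (f := fun δ => (n - 1) * (1 + (b - δ)) - (1 - (a - δ)))
      (g := fun δ => (n - 1) * (1 + (b - δ)) - (1 - (a - δ)) -
        γ * ((m - 1) * (1 + (b - δ)) + (1 - (a - δ))))
      (by fun_prop) (by fun_prop) (by simpa using hN) (by simpa using hlt) ha0
    exact le_transpose_exponent_of_lt_uniform_individual Θ hn hm hnm hΘ (sub_pos.2 hδb)
      (by linarith) (by rw [ha]; exact EReal.coe_lt_coe_iff.2 (by linarith))
      (by rw [hb]; exact EReal.coe_lt_coe_iff.2 (by linarith)) hγ h1 (sub_pos.1 h2)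

theorem bound₃_le (hn : 1 ≤ n) (hm : 1 ≤ m) (hnm : ¬ (n = 1 ∧ m = 1))
    (hrank : Set.finrank ℤ (exactSolutions Θ) ≠ 1) :
    bound₃ n m (uniformExponent Θ) (individualExponent Θ) ≤ individualExponent Θ.transpose := by
  have hmn : (3 : ℝ) ≤ n + m := by exact_mod_cast (show 3 ≤ n + m by omega)
  have hapos := uniformExponent_pos Θ hm
  have hab := uniformExponent_le_individualExponent Θ hm
  have hpos : 0 < individualExponent Θ := hapos.trans_le hab
  have hpos' : 0 < individualExponent Θ.transpose :=
    (uniformExponent_pos _ hn).trans_le (uniformExponent_le_individualExponent _ hn)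
  have hb0 := inv_toReal_nonneg hpos
  have hba := inv_toReal_anti hapos hab
  unfold bound₃
  refine quot_le hpos'.le (by nlinarith) fun γ hγ hN hlt => ?_
  by_cases hex : ∃ x y, x ≠ 0 ∧ errorVec Θ x y = 0
  · obtain ⟨x₁, y₁, hx₁, hxy₁⟩ := hex
    obtain ⟨x₂, h₂, hind⟩ := exists_independent_exactSolution Θ hrank hx₁ ⟨y₁, hxy₁⟩
    have htop := uniformExponent_eq_top Θ hx₁ hxy₁
    have htop' : individualExponent Θ = ⊤ := top_le_iff.1 (htop ▸ hab)
    -- Both exponents are infinite, so the bound reads `n / (m - 2)`.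
    rw [htop, htop', EReal.inv_top, EReal.toReal_zero] at hlt
    exact le_transpose_exponent_of_exact Θ hn hm hnm hx₁ ⟨y₁, hxy₁⟩ h₂ hind hγ (by linarith)
  · push Not at hex
    set a := ((uniformExponent Θ)⁻¹).toReal
    set b := ((individualExponent Θ)⁻¹).toReal
    -- Raising both inverses by `δ` puts the exponents strictly below their suprema, infinite ones
    -- included.
    obtain ⟨δ, hδ0, -, h1, h2⟩ := exists_pos_lt_of_continuous
      (f := fun δ => (n - 1) * (1 + (b + δ)) - ((a + δ) - 1))
      (g := fun δ => (n - 1) * (1 + (b + δ)) - ((a + δ) - 1) -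
        γ * ((m - 1) * (1 + (b + δ)) + ((a + δ) - 1)))
      (by fun_prop) (by fun_prop) (by simpa using hN) (by simpa using hlt) one_pos
    exact le_transpose_exponent_of_lt_inv Θ hn hm hnm hex (by linarith) (by linarith)
      (inv_inv_toReal_add_lt hapos hδ0) (inv_inv_toReal_add_lt hpos hδ0) hγ h1 (sub_pos.1 h2)

end

end Diophantine

theorem theorem4 (n m : ℕ) (hn : 1 ≤ n) (hm : 1 ≤ m) (hnm : ¬ (n = 1 ∧ m = 1))
    (Θ : Matrix (Fin n) (Fin m) ℝ) :
    Diophantine.bound₁ n m (Diophantine.individualExponent Θ)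
        ≤ Diophantine.individualExponent Θ.transpose ∧
    (∀ a : ℝ, Diophantine.uniformExponent Θ = (a : EReal) →
      Diophantine.bound₂ n m a (Diophantine.individualExponent Θ)
        ≤ Diophantine.individualExponent Θ.transpose) ∧
    (Set.finrank ℤ (Diophantine.exactSolutions Θ) ≠ 1 →
      Diophantine.bound₃ n m (Diophantine.uniformExponent Θ) (Diophantine.individualExponent Θ)
        ≤ Diophantine.individualExponent Θ.transpose) := by
  exact ⟨Diophantine.bound₁_le Θ hn hm, fun _ ha => Diophantine.bound₂_le Θ hn hm hnm ha,
    Diophantine.bound₃_le Θ hn hm hnm⟩
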